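/- **Setting.** Let $n\ge 1$, let $\mathcal Z$ be a set with fixed (deterministic) points $Z_1,\dots,Z_n\in\mathcal Z$, and let $f:\mathcal Z\to\mathbb R$. We observe $Y_i=f(Z_i)+\xi_i$, $i=1,\dots,n$, where the errors $\xi_i$ are independent and identically distributed, integrable, with mean zero. Let $\Lambda$ be a measurable space and $\{f_\lambda:\lambda\in\Lambda\}$ a family of functions $f_\lambda:\mathcal Z\to\mathbb R$ such that $\lambda\mapsto f_\lambda(z)$ is measurable for every $z\in\mathcal Z$. Write $\|h\|_n=\big(\frac1n\sum_{i=1}^n h(Z_i)^2\big)^{1/2}$ and $$L=\sup_{\lambda,\lambda'\in\Lambda}\ \max_{1\le i\le n}|f_\lambda(Z_i)-f_{\lambda'}(Z_i)|\in[0,\infty].$$ For a probability measure $\pi$ on $\Lambda$ (the prior) and $\beta>0$, the exponentially weighted aggregate is $$\widehat f_n(z)=\int_\Lambda f_\lambda(z)\,\widehat\pi_{n,\beta}(d\lambda),\qquad \widehat\pi_{n,\beta}(d\lambda)\propto\exp\Big\{-\frac1\beta\sum_{i=1}^n\big(Y_i-f_\lambda(Z_i)\big)^2\Big\}\,\pi(d\lambda),$$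 where $\widehat\pi_{n,\beta}$ is normalized to be a probability measure. **Assumption N**, with parameter $t_0\in(0,\infty]$ and bounded Borel function $v:\mathbb R\to[0,\infty)$: for every small enough $\gamma>0$ there exist random variables $\xi,\zeta$ (depending on $\gamma$) on a common probability space such that (i) $\xi$ has the law of the errors $\xi_i$; (ii) $\xi+\zeta$ has the same law as $(1+\gamma)\xi$, and $\mathbf E[\zeta\mid\xi]=0$; (iii) for suitable versions of the conditional expectations, $$\limsup_{\gamma\to0^+}\ \sup_{|t|\le t_0,\ t\in\mathbb R,\ a\in\operatorname{supp}(\xi)}\frac{\log\mathbf E[e^{t\zeta}\mid\xi=a]}{t^2\gamma\,v(a)}\le 1,$$ where $\operatorname{supp}(\xi)$ is the support of the law of $\xi$, $\frac00=0$, and $\frac x0=\infty$ for $x>0$. **Theorem.** Suppose that Assumption N holds with $t_0$ and $v$, and put $\|v\|_\infty=\sup_{a\in\mathbb R}v(a)$. Then for every prior $\pi$, every probability measure $p$ on $\Lambda$ and every real $\beta>0$ with $$\beta\ \ge\ \max\Big(4\|v\|_\infty,\ \frac{2L}{t_0}\Big),\qquad\text{with the convention } \frac{\infty}{\infty}=0,$$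 one has $$\mathbf E\big[\|\widehat f_n-f\|_n^2\big]\ \le\ \int_\Lambda\|f-f_\lambda\|_n^2\,p(d\lambda)+\frac{\beta\,\mathcal K(p,\pi)}n,$$ where $\mathcal K(p,\pi)\in[0,\infty]$ is the Kullback–Leibler divergence, equal to $+\infty$ if $p$ is not absolutely continuous with respect to $\pi$; both sides may be $+\infty$. In particular the bound holds for $L=t_0=\infty$ (unbounded families) as soon as $\beta\ge4\|v\|_\infty$. -/

import Mathlib

open MeasureTheory ProbabilityTheory Filter Topology
open scoped ENNReal NNReal

/-- `IsDilationPair μ γ P ξ ζ κ`: on the probability space `(Ω, P)` the variable `ξ` has law `μ`, the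
sum `ξ + ζ` has the law of `(1 + γ) ξ`, and `E[ζ | ξ] = 0`; the Markov kernel `κ` is a version of the
conditional distribution of `ζ` given `ξ`, i.e. `κ a` is the law of `ζ` given `ξ = a`. -/
structure IsDilationPair (μ : Measure ℝ) (γ : ℝ) {Ω : Type} [MeasurableSpace Ω] (P : Measure Ω)
    (ξ ζ : Ω → ℝ) (κ : Kernel ℝ ℝ) : Prop where
  isProbabilityMeasure : IsProbabilityMeasure P
  measurable_noise : Measurable ξ
  measurable_perturbation : Measurable ζ
  law_noise : P.map ξ = μ
  law_sum : P.map (fun ω => ξ ω + ζ ω) = μ.map (fun x => (1 + γ) * x)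
  integrable_perturbation : Integrable ζ P
  condExp_eq_zero : P[ζ | MeasurableSpace.comap ξ inferInstance] =ᵐ[P] 0
  isMarkovKernel : IsMarkovKernel κ
  conditional_law : P.map (fun ω => (ξ ω, ζ ω)) = μ ⊗ₘ κ

/-- The quotient `log E[exp (t ζ) | ξ = a] / (t² γ v(a))`, where `κ a` is the law of `ζ` given `ξ = a`.
It is computed in `[0, ∞]`, so that `0 / 0 = 0` (this covers `t = 0`) and `x / 0 = ∞` for `x ≠ 0`.
The logarithm is nonnegative for a centred conditional law, so taking its positive part loses nothing. -/
noncomputable def logLaplaceRatio (κ : Kernel ℝ ℝ) (γ : ℝ) (v : ℝ → ℝ≥0) (t a : ℝ) : ℝ≥0∞ :=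
  (ENNReal.log (∫⁻ z, ENNReal.ofReal (Real.exp (t * z)) ∂(κ a))).toENNReal /
    (ENNReal.ofReal (t ^ 2 * γ) * (v a : ℝ≥0∞))

/-- Assumption N on the law `μ` of the noise, with parameter `t₀ ∈ (0, ∞]` and bounded Borel function
`v : ℝ → [0, ∞)`: for every small enough `γ > 0` there is a pair `(ξ, ζ)` with `ξ ∼ μ`,
`ξ + ζ ∼ (1 + γ) ξ`, `E[ζ | ξ] = 0`, and
`limsup_{γ → 0+} sup_{|t| ≤ t₀, a ∈ supp μ} log E[exp (t ζ) | ξ = a] / (t² γ v(a)) ≤ 1`.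
As usual the conditional expectation given `ξ = a` is taken in some version. The pair may live on any
probability space; only its joint law matters, hence nothing is lost by taking the space in `Type`. -/
def AssumptionN (μ : Measure ℝ) (t₀ : ℝ≥0∞) (v : ℝ → ℝ≥0) : Prop :=
  0 < t₀ ∧ Measurable v ∧ BddAbove (Set.range v) ∧
  ∃ (Ω : ℝ → Type) (_ : ∀ γ, MeasurableSpace (Ω γ)) (P : ∀ γ, Measure (Ω γ))
    (ξ ζ : ∀ γ, Ω γ → ℝ) (κ : ℝ → Kernel ℝ ℝ),
    (∀ᶠ γ in 𝓝[>] (0 : ℝ), IsDilationPair μ γ (P γ) (ξ γ) (ζ γ) (κ γ)) ∧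
    limsup (fun γ => ⨆ (t : ℝ) (_ : ENNReal.ofReal |t| ≤ t₀) (a : ℝ) (_ : a ∈ μ.support),
      logLaplaceRatio (κ γ) γ v t a) (𝓝[>] (0 : ℝ)) ≤ 1

/-- The sup-norm `‖v‖_∞` of a nonnegative function on `ℝ`. -/
noncomputable def supNorm (v : ℝ → ℝ≥0) : ℝ≥0∞ := ⨆ a, (v a : ℝ≥0∞)

section Regression

variable {𝒵 Λ : Type*} {n : ℕ}

/-- The empirical norm `‖h‖_n = ((1/n) ∑ h(Z_i)²)^{1/2}` at the design points `Z_1, …, Z_n`. -/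
noncomputable def empiricalNorm (Z : Fin n → 𝒵) (h : 𝒵 → ℝ) : ℝ :=
  Real.sqrt ((1 / (n : ℝ)) * ∑ i, h (Z i) ^ 2)

/-- The smallest `L ∈ [0, ∞]` with `|f_l(Z_i) - f_{l'}(Z_i)| ≤ L` for all `l`, `l'` and `i`. -/
noncomputable def supDeviation (Z : Fin n → 𝒵) (F : Λ → 𝒵 → ℝ) : ℝ≥0∞ :=
  ⨆ (l : Λ) (l' : Λ) (i : Fin n), ENNReal.ofReal |F l (Z i) - F l' (Z i)|

variable [MeasurableSpace Λ]

/-- The posterior: the probability measure proportional to `exp(-‖Y - f_l‖₂² / β) π(dl)`. -/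
noncomputable def posterior (Z : Fin n → 𝒵) (F : Λ → 𝒵 → ℝ) (π : Measure Λ) (β : ℝ)
    (Y : Fin n → ℝ) : Measure Λ :=
  π.tilted (fun l => -(β⁻¹ * ∑ i, (Y i - F l (Z i)) ^ 2))

/-- The exponentially weighted aggregate: the posterior mean `∫ f_l(z) π̂(dl)`. -/
noncomputable def ewa (Z : Fin n → 𝒵) (F : Λ → 𝒵 → ℝ) (π : Measure Λ) (β : ℝ)
    (Y : Fin n → ℝ) : 𝒵 → ℝ :=
  fun z => ∫ l, F l z ∂(posterior Z F π β Y)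

end Regression

/-! Put `g i l = F l (Z i) - f (Z i)`. After completing the square, the posterior for noise x is the
prior tilted by E_x = β⁻¹ ∑ (2 x_i g_i - g_i²), and the error of the aggregate at Z_i is the
posterior mean m_i(x) of g_i; let V_i(x) be the posterior variance. By Jensen, log ∫ exp E_x dπ is
at least its tangent at x = 0 and at most the posterior mean of E_x. Comparing the two
(`log_integral_exp_gibbsExponent_le`) and averaging over the centred noise gives E ∑ m_i² ≤ -β log ∫
exp E_0 dπ + ∑ E[2 ξ_i m_i - V_i]. Donsker–Varadhan turns the first term into the oracle bound, so
everything rests on the Stein-type inequality 2 E[ξ_i m_i] ≤ E V_i.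

With the other coordinates frozen this is one-dimensional (`two_mul_integral_tiltedMean_le`): φ(x) =
log ∫ exp(s x h) dν with s = 2/β is convex with φ' = s m. Hence γ s E[ξ m(ξ)] ≤ E φ((1+γ)ξ) - E φ(ξ)
= E[φ(ξ+ζ) - φ(ξ)]. Given ξ, the term linear in ζ averages to zero, and the Laplace bound controls
the rest by γ s² E[v V], up to a factor 1+ε and O(γ²). The condition β ≥ 4v says s v ≤ 1/2, and β ≥
2L/t₀ keeps the arguments s(h - m) within t₀. Dividing by γ and letting γ, then ε, tend to 0
concludes.

All this is done for bounded g_i; truncating the prior and Fatou give the general case. -/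

section Tilting

/-! ### Convexity and measurability for exponential tilts -/

variable {Λ : Type*} [MeasurableSpace Λ] {ν : Measure Λ}

lemma exp_integral_le [IsProbabilityMeasure ν] {X : Λ → ℝ} (hX : Integrable X ν)
    (hexp : Integrable (fun l => Real.exp (X l)) ν) :
    Real.exp (∫ l, X l ∂ν) ≤ ∫ l, Real.exp (X l) ∂ν :=
  convexOn_exp.map_integral_le Real.continuous_exp.continuousOn isClosed_univ
    (ae_of_all _ fun _ => Set.mem_univ _) hX hexp

/-- Jensen under the tilted measure: the convex log-partition function lies above its tangent at
`T`. -/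
lemma integral_tilted_le_log_sub_log [NeZero ν] {T D : Λ → ℝ}
    (hT : Integrable (fun l => Real.exp (T l)) ν)
    (hTD : Integrable (fun l => Real.exp (T l + D l)) ν) (hD : Integrable D (ν.tilted T)) :
    ∫ l, D l ∂(ν.tilted T) ≤
      Real.log (∫ l, Real.exp (T l + D l) ∂ν) - Real.log (∫ l, Real.exp (T l) ∂ν) := by
  have := isProbabilityMeasure_tilted hT
  have hexp : Integrable (fun l => Real.exp (D l)) (ν.tilted T) := by
    rw [integrable_tilted_iff hT]
    simpa [← Real.exp_add] using hTD
  have h := exp_integral_le hD hexp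
  rw [integral_exp_tilted] at h
  rw [← Real.log_div (integral_exp_pos hTD).ne' (integral_exp_pos hT).ne',
    Real.le_log_iff_exp_le (div_pos (integral_exp_pos hTD) (integral_exp_pos hT))]
  exact h

lemma stronglyMeasurable_integral_tilted {X : Type*} [MeasurableSpace X] [SFinite ν]
    {T g : X → Λ → ℝ} (hT : Measurable (Function.uncurry T))
    (hg : Measurable (Function.uncurry g)) :
    StronglyMeasurable (fun x => ∫ l, g x l ∂(ν.tilted (T x))) := by
  simp_rw [integral_tilted, smul_eq_mul]
  have hW : StronglyMeasurable (fun x => ∫ l, Real.exp (T x l) ∂ν) :=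
    StronglyMeasurable.integral_prod_right (f := fun x l => Real.exp (T x l))
      (Real.measurable_exp.comp hT).stronglyMeasurable
  refine StronglyMeasurable.integral_prod_right
    (f := fun x l => Real.exp (T x l) / (∫ l, Real.exp (T x l) ∂ν) * g x l) ?_
  refine Measurable.stronglyMeasurable ?_
  exact (((Real.measurable_exp.comp hT)).div (hW.measurable.comp measurable_fst)).mul hg

lemma abs_integral_le_of_ae_abs_le [IsProbabilityMeasure ν] {g : Λ → ℝ} {M : ℝ}
    (h : ∀ᵐ l ∂ν, |g l| ≤ M) : |∫ l, g l ∂ν| ≤ M := by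
  have := norm_integral_le_of_norm_le_const (μ := ν) (f := g) h
  simpa using this

lemma integrable_of_ae_abs_le [IsFiniteMeasure ν] {g : Λ → ℝ} (hg : Measurable g) {M : ℝ}
    (h : ∀ᵐ l ∂ν, |g l| ≤ M) : Integrable g ν :=
  Integrable.of_bound hg.aestronglyMeasurable M h

lemma integrable_exp_of_ae_abs_le [IsFiniteMeasure ν] {g : Λ → ℝ} (hg : Measurable g) {M : ℝ}
    (h : ∀ᵐ l ∂ν, |g l| ≤ M) : Integrable (fun l => Real.exp (g l)) ν := by
  refine integrable_of_ae_abs_le (Real.measurable_exp.comp hg) (M := Real.exp M) ?_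
  filter_upwards [h] with l hl
  rw [abs_of_pos (Real.exp_pos _)]
  exact Real.exp_le_exp.2 ((le_abs_self _).trans hl)

end Tilting

/-! ### What Assumption N provides at a fixed small γ -/

lemma lintegral_exp_le_of_logLaplaceRatio_le {κ : Kernel ℝ ℝ} {γ ε t a : ℝ} {v : ℝ → ℝ≥0}
    (hγ : 0 ≤ γ) (hε : 0 ≤ ε) (h : logLaplaceRatio κ γ v t a ≤ ENNReal.ofReal (1 + ε)) :
    ∫⁻ z, ENNReal.ofReal (Real.exp (t * z)) ∂(κ a) ≤
      ENNReal.ofReal (Real.exp ((1 + ε) * (t ^ 2 * γ * v a))) := by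
  set I := ∫⁻ z, ENNReal.ofReal (Real.exp (t * z)) ∂(κ a)
  have h1 : (ENNReal.log I).toENNReal ≤ ENNReal.ofReal ((1 + ε) * (t ^ 2 * γ * v a)) := by
    have hd : ENNReal.ofReal (t ^ 2 * γ) * (v a : ℝ≥0∞) = ENNReal.ofReal (t ^ 2 * γ * v a) := by
      rw [ENNReal.ofReal_mul (p := t ^ 2 * γ) (by positivity), ENNReal.ofReal_coe_nnreal]
    rw [ENNReal.ofReal_mul (by positivity), ← hd]
    unfold logLaplaceRatio at h
    -- The denominator may be 0; since the bound 1 + ε is finite, the convention x/0 = ∞ then forces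
    -- the numerator to vanish too.
    rwa [ENNReal.div_le_iff_le_mul (Or.inr ENNReal.ofReal_ne_top)
      (Or.inl (hd ▸ ENNReal.ofReal_ne_top))] at h
  have h2 : ENNReal.log I ≤ (((1 + ε) * (t ^ 2 * γ * v a) : ℝ) : EReal) := by
    refine (EReal.coe_toENNReal_eq_max.symm ▸ le_max_right _ _).trans ((EReal.coe_ennreal_le_coe_ennreal_iff.2 h1).trans ?_)
    rw [EReal.coe_ennreal_ofReal, max_eq_left (by positivity)]
  rw [← ENNReal.log_le_log_iff, ENNReal.log_ofReal_of_pos (Real.exp_pos _), Real.log_exp]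
  exact h2

/-- The slack ε turns a limsup at most 1 into a strict bound 1 + ε on the supremum for all small γ,
uniformly in `t` and `a`. -/
lemma AssumptionN.eventually_exists {μ : Measure ℝ} {t₀ : ℝ≥0∞} {v : ℝ → ℝ≥0}
    (hN : AssumptionN μ t₀ v) {ε : ℝ} (hε : 0 < ε) :
    ∀ᶠ γ in 𝓝[>] (0 : ℝ), ∃ (Ω : Type) (_ : MeasurableSpace Ω) (P : Measure Ω) (ξ ζ : Ω → ℝ)
      (κ : Kernel ℝ ℝ), IsDilationPair μ γ P ξ ζ κ ∧
      ∀ t, ENNReal.ofReal |t| ≤ t₀ → ∀ a ∈ μ.support,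
        ∫⁻ z, ENNReal.ofReal (Real.exp (t * z)) ∂(κ a) ≤
          ENNReal.ofReal (Real.exp ((1 + ε) * (t ^ 2 * γ * v a))) := by
  obtain ⟨-, -, -, Ω, mΩ, P, ξ, ζ, κ, hpair, hlim⟩ := hN
  have hlt := eventually_lt_of_limsup_lt (hlim.trans_lt
    (show (1 : ℝ≥0∞) < ENNReal.ofReal (1 + ε) by
      rw [← ENNReal.ofReal_one, ENNReal.ofReal_lt_ofReal_iff (by linarith)]; linarith))
  filter_upwards [hpair, hlt, self_mem_nhdsWithin] with γ h1 h2 h3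
  refine ⟨Ω γ, mΩ γ, P γ, ξ γ, ζ γ, κ γ, h1, fun t ht a ha => ?_⟩
  refine lintegral_exp_le_of_logLaplaceRatio_le (le_of_lt h3) hε.le (le_trans ?_ h2.le)
  refine le_iSup_of_le t (le_iSup_of_le ht (le_iSup_of_le a (le_iSup_of_le ha le_rfl)))

/-- The factor `m (ξ ω)` is ξ-measurable, so it comes out of E[ζ | ξ] = 0. This kills the term
linear in ζ. -/
lemma IsDilationPair.integral_mul_eq_zero {μ : Measure ℝ} {γ : ℝ} {Ω : Type} [MeasurableSpace Ω]
    {P : Measure Ω} {ξ ζ : Ω → ℝ} {κ : Kernel ℝ ℝ} (h : IsDilationPair μ γ P ξ ζ κ)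
    {m : ℝ → ℝ} (hm : Measurable m) {M : ℝ} (hM : ∀ x, |m x| ≤ M) :
    Integrable (fun ω => m (ξ ω) * ζ ω) P ∧ ∫ ω, m (ξ ω) * ζ ω ∂P = 0 := by
  have := h.isProbabilityMeasure
  have hint : Integrable (fun ω => m (ξ ω) * ζ ω) P :=
    h.integrable_perturbation.bdd_mul (hm.comp h.measurable_noise).aestronglyMeasurable
      (ae_of_all _ fun ω => hM (ξ ω))
  refine ⟨hint, ?_⟩
  have hle : MeasurableSpace.comap ξ inferInstance ≤ (inferInstance : MeasurableSpace Ω) :=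
    h.measurable_noise.comap_le
  have hsm : StronglyMeasurable[MeasurableSpace.comap ξ inferInstance] (fun ω => m (ξ ω)) :=
    (hm.comp (comap_measurable ξ)).stronglyMeasurable
  have hc := condExp_mul_of_stronglyMeasurable_left hsm hint h.integrable_perturbation
  rw [← integral_condExp hle]
  refine (integral_congr_ae (g := fun _ => (0 : ℝ)) (hc.trans ?_)).trans (integral_zero _ _)
  filter_upwards [h.condExp_eq_zero] with ω hω
  simp [hω]

/-! ### Moments along a one-parameter tilt -/

section TiltedMoments

variable {Λ : Type*} [MeasurableSpace Λ] {ν : Measure Λ}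

/-- The mean of `h` under the exponential tilt of `ν` by `x * h`. -/
noncomputable def tiltedMean (ν : Measure Λ) (h : Λ → ℝ) (x : ℝ) : ℝ :=
  ∫ l, h l ∂(ν.tilted fun l => x * h l)

/-- The variance of `h` under the exponential tilt of `ν` by `x * h`. -/
noncomputable def tiltedVar (ν : Measure Λ) (h : Λ → ℝ) (x : ℝ) : ℝ :=
  ∫ l, (h l - tiltedMean ν h x) ^ 2 ∂(ν.tilted fun l => x * h l)

lemma measurable_tiltedMean [SFinite ν] {h : Λ → ℝ} (hh : Measurable h) :
    Measurable (tiltedMean ν h) :=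
  (stronglyMeasurable_integral_tilted (X := ℝ) (T := fun x l => x * h l) (g := fun _ l => h l)
    (by unfold Function.uncurry; fun_prop) (by unfold Function.uncurry; fun_prop)).measurable

lemma measurable_tiltedVar [SFinite ν] {h : Λ → ℝ} (hh : Measurable h) :
    Measurable (tiltedVar ν h) := by
  have := measurable_tiltedMean (ν := ν) hh
  exact (stronglyMeasurable_integral_tilted (X := ℝ) (T := fun x l => x * h l)
    (g := fun x l => (h l - tiltedMean ν h x) ^ 2)
    (by unfold Function.uncurry; fun_prop) (by unfold Function.uncurry; fun_prop)).measurable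

lemma ae_abs_mul_le {h : Λ → ℝ} {M : ℝ} (hM : ∀ᵐ l ∂ν, |h l| ≤ M) (c : ℝ) :
    ∀ᵐ l ∂ν, |c * h l| ≤ |c| * M := by
  filter_upwards [hM] with l hl
  rw [abs_mul]
  gcongr

lemma isProbabilityMeasure_tilted_of_ae_abs_le [IsFiniteMeasure ν] [NeZero ν] {T : Λ → ℝ}
    (hT : Measurable T) {M : ℝ} (hM : ∀ᵐ l ∂ν, |T l| ≤ M) :
    IsProbabilityMeasure (ν.tilted T) :=
  isProbabilityMeasure_tilted (integrable_exp_of_ae_abs_le hT hM)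

lemma abs_tiltedMean_le [IsProbabilityMeasure ν] {h : Λ → ℝ} (hh : Measurable h) {M : ℝ}
    (hM : ∀ᵐ l ∂ν, |h l| ≤ M) (x : ℝ) : |tiltedMean ν h x| ≤ M := by
  have := isProbabilityMeasure_tilted_of_ae_abs_le (hh.const_mul x) (ae_abs_mul_le hM x)
  exact abs_integral_le_of_ae_abs_le ((tilted_absolutelyContinuous ν _).ae_le hM)

lemma ae_sq_sub_tiltedMean_le [IsProbabilityMeasure ν] {h : Λ → ℝ} (hh : Measurable h) {M : ℝ}
    (hM : ∀ᵐ l ∂ν, |h l| ≤ M) (x : ℝ) :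
    ∀ᵐ l ∂ν, (h l - tiltedMean ν h x) ^ 2 ≤ (2 * M) ^ 2 := by
  filter_upwards [hM] with l hl
  refine sq_le_sq' ?_ ?_ <;>
    linarith [abs_le.1 hl, abs_le.1 (abs_tiltedMean_le hh hM x), (abs_le.1 hl).1, (abs_le.1 hl).2,
      (abs_le.1 (abs_tiltedMean_le hh hM x)).1, (abs_le.1 (abs_tiltedMean_le hh hM x)).2]

lemma abs_tiltedVar_le [IsProbabilityMeasure ν] {h : Λ → ℝ} (hh : Measurable h) {M : ℝ}
    (hM : ∀ᵐ l ∂ν, |h l| ≤ M) (x : ℝ) : |tiltedVar ν h x| ≤ (2 * M) ^ 2 := by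
  have := isProbabilityMeasure_tilted_of_ae_abs_le (hh.const_mul x) (ae_abs_mul_le hM x)
  refine abs_integral_le_of_ae_abs_le ((tilted_absolutelyContinuous ν _).ae_le ?_)
  filter_upwards [ae_sq_sub_tiltedMean_le hh hM x] with l hl
  rwa [abs_of_nonneg (sq_nonneg _)]

lemma integral_const_add_mul_add_const [IsProbabilityMeasure ν] {g : Λ → ℝ} (hg : Integrable g ν)
    (a b c : ℝ) : ∫ l, (a + b * g l + c) ∂ν = a + b * (∫ l, g l ∂ν) + c := by
  have h : Integrable (fun l => a + b * g l) ν := (integrable_const a).add (hg.const_mul b)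
  rw [integral_add h (integrable_const c), integral_add (integrable_const a) (hg.const_mul b),
    integral_const_mul]
  simp

lemma abs_log_integral_exp_le [IsProbabilityMeasure ν] {D : Λ → ℝ} (hD : Measurable D) {K : ℝ}
    (hK : ∀ᵐ l ∂ν, |D l| ≤ K) : |Real.log (∫ l, Real.exp (D l) ∂ν)| ≤ K := by
  have hint := integrable_exp_of_ae_abs_le hD hK
  have hpos := integral_exp_pos hint
  rw [abs_le]
  constructor
  · rw [Real.le_log_iff_exp_le hpos]
    have : ∫ _, Real.exp (-K) ∂ν ≤ ∫ l, Real.exp (D l) ∂ν := by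
      refine integral_mono_ae (integrable_const _) hint ?_
      filter_upwards [hK] with l hl using Real.exp_le_exp.2 (abs_le.1 hl).1
    simpa using this
  · rw [Real.log_le_iff_le_exp hpos]
    have : ∫ l, Real.exp (D l) ∂ν ≤ ∫ _, Real.exp K ∂ν := by
      refine integral_mono_ae hint (integrable_const _) ?_
      filter_upwards [hK] with l hl using Real.exp_le_exp.2 (abs_le.1 hl).2
    simpa using this

/-- This is log u ≤ u - 1 with u = e^{-c} times the ratio of partition functions. Taking `c` to be
the tilted mean of `D` leaves a remainder of second order. -/
lemma log_sub_log_le_integral_tilted [NeZero ν] {T D : Λ → ℝ} (c : ℝ)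
    (hT : Integrable (fun l => Real.exp (T l)) ν)
    (hTD : Integrable (fun l => Real.exp (T l + D l)) ν) :
    Real.log (∫ l, Real.exp (T l + D l) ∂ν) - Real.log (∫ l, Real.exp (T l) ∂ν) ≤
      c + (∫ l, Real.exp (D l - c) ∂(ν.tilted T) - 1) := by
  have h1 := integral_exp_pos hT
  have h2 := integral_exp_pos hTD
  have he : ∫ l, Real.exp (D l - c) ∂(ν.tilted T) =
      Real.exp (-c) * ((∫ l, Real.exp (T l + D l) ∂ν) / ∫ l, Real.exp (T l) ∂ν) := by
    have := integral_exp_tilted (μ := ν) T D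
    simp only [Pi.add_apply] at this
    rw [← this, ← integral_const_mul]
    congr with l
    rw [← Real.exp_add]; ring_nf
  have := Real.log_le_sub_one_of_pos (show 0 < Real.exp (-c) *
    ((∫ l, Real.exp (T l + D l) ∂ν) / ∫ l, Real.exp (T l) ∂ν) by positivity)
  rw [he]
  rw [Real.log_mul (Real.exp_pos _).ne' (by positivity), Real.log_exp,
    Real.log_div h2.ne' h1.ne'] at this
  linarith

end TiltedMoments

/-! ### The one-dimensional Stein-type inequality -/

section Dilation

variable {Λ : Type*} [MeasurableSpace Λ] {ν : Measure Λ} [IsProbabilityMeasure ν] {h : Λ → ℝ}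
  {M : ℝ}

/-- Bound on the conditional expectation of the second-order remainder: Tonelli integrates over ζ
first, where the Laplace bound applies at `t = s * (h l - m)`, and exp y ≤ 1 + y + y² makes the
result quadratic in h - m. -/
lemma lintegral_tilted_exp_le (hh : Measurable h) (hM : ∀ᵐ l ∂ν, |h l| ≤ M) {κ : Measure ℝ}
    [SFinite κ] {s x γ ε : ℝ} {w : ℝ≥0} {t₀ : ℝ≥0∞} (hs : 0 ≤ s) (hγ : 0 ≤ γ) (hε : 0 ≤ ε)
    (hε1 : ε ≤ 1)
    (hκ : ∀ t, ENNReal.ofReal |t| ≤ t₀ → ∫⁻ z, ENNReal.ofReal (Real.exp (t * z)) ∂κ ≤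
      ENNReal.ofReal (Real.exp ((1 + ε) * (t ^ 2 * γ * w))))
    (ht : ∀ᵐ l ∂ν, ENNReal.ofReal |s * (h l - tiltedMean ν h (s * x))| ≤ t₀)
    (hw : s * w ≤ 1 / 2) (hγM : s * (2 * M) ^ 2 * γ ≤ 1) :
    ∫⁻ z, ENNReal.ofReal (∫ l, Real.exp (s * z * h l - s * z * tiltedMean ν h (s * x))
      ∂(ν.tilted fun l => s * x * h l)) ∂κ ≤
    ENNReal.ofReal (1 + (1 + ε) * γ * (s / 2) * tiltedVar ν h (s * x) +
      (s * (2 * M) ^ 2 * γ) ^ 2) := by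
  have := isProbabilityMeasure_tilted_of_ae_abs_le (hh.const_mul (s * x)) (ae_abs_mul_le hM (s * x))
  have hac := tilted_absolutelyContinuous ν (fun l => s * x * h l)
  unfold tiltedVar
  set m := tiltedMean ν h (s * x) with hm
  set θ := ν.tilted fun l => s * x * h l
  have hMθ := hac.ae_le hM
  have hsq : ∀ᵐ l ∂θ, (h l - m) ^ 2 ≤ (2 * M) ^ 2 :=
    hac.ae_le (ae_sq_sub_tiltedMean_le hh hM (s * x))
  have hexp : ∀ z, Integrable (fun l => Real.exp (s * z * h l - s * z * m)) θ := fun z => by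
    refine integrable_exp_of_ae_abs_le (by fun_prop) (M := |s * z| * M + |s * z * m|) ?_
    filter_upwards [ae_abs_mul_le hMθ (s * z)] with l hl
    exact (abs_sub _ _).trans (by gcongr)
  have hsqint : Integrable (fun l => (h l - m) ^ 2) θ := by
    refine integrable_of_ae_abs_le (by fun_prop) (M := (2 * M) ^ 2) ?_
    filter_upwards [hsq] with l hl
    rwa [abs_of_nonneg (sq_nonneg _)]
  have hBint : Integrable (fun l => 1 + (1 + ε) * γ * (s / 2) * (h l - m) ^ 2 +
      (s * (2 * M) ^ 2 * γ) ^ 2) θ :=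
    (((integrable_const _).add (hsqint.const_mul _)).add (integrable_const _))
  have hBeq : ∫ l, (1 + (1 + ε) * γ * (s / 2) * (h l - m) ^ 2 +
      (s * (2 * M) ^ 2 * γ) ^ 2) ∂θ = 1 + (1 + ε) * γ * (s / 2) * (∫ l, (h l - m) ^ 2 ∂θ) +
      (s * (2 * M) ^ 2 * γ) ^ 2 := by
    exact integral_const_add_mul_add_const hsqint _ _ _
  calc ∫⁻ z, ENNReal.ofReal (∫ l, Real.exp (s * z * h l - s * z * m) ∂θ) ∂κ
      = ∫⁻ z, ∫⁻ l, ENNReal.ofReal (Real.exp (s * (h l - m) * z)) ∂θ ∂κ := by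
        refine lintegral_congr fun z => ?_
        rw [ofReal_integral_eq_lintegral_ofReal (hexp z) (ae_of_all _ fun l => (Real.exp_pos _).le)]
        refine lintegral_congr fun l => ?_
        ring_nf
    _ = ∫⁻ l, ∫⁻ z, ENNReal.ofReal (Real.exp (s * (h l - m) * z)) ∂κ ∂θ := by
        refine lintegral_lintegral_swap (Measurable.aemeasurable ?_)
        unfold Function.uncurry
        fun_prop
    _ ≤ ∫⁻ l, ENNReal.ofReal (1 + (1 + ε) * γ * (s / 2) * (h l - m) ^ 2 +
          (s * (2 * M) ^ 2 * γ) ^ 2) ∂θ := by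
        refine lintegral_mono_ae ?_
        filter_upwards [hac.ae_le ht, hsq] with l hl hl2
        refine (hκ _ hl).trans (ENNReal.ofReal_le_ofReal ?_)
        -- The Laplace exponent carries s² w; `hw` lowers it to s/2. Since ε ≤ 1, y is at most
        -- s(2M)²γ ≤ 1, where the expansion of exp is valid.
        set y := (1 + ε) * γ * (s / 2) * (h l - m) ^ 2 with hy
        have hy0 : 0 ≤ y := by positivity
        have hyC : y ≤ s * (2 * M) ^ 2 * γ := by
          calc y ≤ (1 + 1) * γ * (s / 2) * (2 * M) ^ 2 := by rw [hy]; gcongr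
            _ = _ := by ring
        have h1 : (1 + ε) * ((s * (h l - m)) ^ 2 * γ * w) ≤ y := by
          have : 0 ≤ (1 + ε) * γ * s * (h l - m) ^ 2 := by positivity
          nlinarith [mul_le_mul_of_nonneg_left hw this]
        have h2 := abs_le.1 (Real.abs_exp_sub_one_sub_id_le (x := y)
          (by rw [abs_of_nonneg hy0]; linarith))
        have h3 : y ^ 2 ≤ (s * (2 * M) ^ 2 * γ) ^ 2 := by gcongr
        linarith [Real.exp_le_exp.2 h1, h2.2]
    _ = ENNReal.ofReal (∫ l, (1 + (1 + ε) * γ * (s / 2) * (h l - m) ^ 2 +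
          (s * (2 * M) ^ 2 * γ) ^ 2) ∂θ) := by
        rw [ofReal_integral_eq_lintegral_ofReal hBint]
        exact ae_of_all _ fun l => by positivity
    _ = _ := by rw [hBeq]

/-- The increment E φ((1+γ)ξ) - E φ(ξ) is bounded below by convexity and above by writing (1+γ)ξ in
law as ξ + ζ. -/
lemma mul_integral_tiltedMean_le_of_isDilationPair (hh : Measurable h) (hM : ∀ᵐ l ∂ν, |h l| ≤ M)
    {μ : Measure ℝ} [IsProbabilityMeasure μ] (hint : Integrable (fun x : ℝ => x) μ)
    {Ω : Type} [MeasurableSpace Ω] {P : Measure Ω} {ξ ζ : Ω → ℝ} {κ : Kernel ℝ ℝ}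
    {s γ ε : ℝ} {v : ℝ → ℝ≥0} {t₀ : ℝ≥0∞} (hs : 0 ≤ s) (hγ : 0 ≤ γ) (hε : 0 ≤ ε) (hε1 : ε ≤ 1)
    (hpair : IsDilationPair μ γ P ξ ζ κ)
    (hκ : ∀ t, ENNReal.ofReal |t| ≤ t₀ → ∀ a ∈ μ.support,
      ∫⁻ z, ENNReal.ofReal (Real.exp (t * z)) ∂(κ a) ≤
        ENNReal.ofReal (Real.exp ((1 + ε) * (t ^ 2 * γ * v a))))
    (ht : ∀ x, ∀ᵐ l ∂ν, ENNReal.ofReal |s * (h l - tiltedMean ν h (s * x))| ≤ t₀)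
    (hv : ∀ a, s * v a ≤ 1 / 2) (hγM : s * (2 * M) ^ 2 * γ ≤ 1) :
    γ * (s * ∫ x, x * tiltedMean ν h (s * x) ∂μ) ≤
      (1 + ε) * γ * (s / 2) * ∫ x, tiltedVar ν h (s * x) ∂μ + (s * (2 * M) ^ 2 * γ) ^ 2 := by
  have := hpair.isProbabilityMeasure
  have := hpair.isMarkovKernel
  have hξm := hpair.measurable_noise
  have hζm := hpair.measurable_perturbation
  set φ : ℝ → ℝ := fun x => Real.log (∫ l, Real.exp (s * x * h l) ∂ν) with hφ
  set m : ℝ → ℝ := fun x => tiltedMean ν h (s * x) with hm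
  set R : ℝ × ℝ → ℝ := fun p => ∫ l, Real.exp (s * p.2 * h l - s * p.2 * m p.1)
    ∂(ν.tilted fun l => s * p.1 * h l) with hR
  have hmm : Measurable m := (measurable_tiltedMean hh).comp (measurable_const_mul s)
  have hmM : ∀ x, |m x| ≤ M := fun x => abs_tiltedMean_le hh hM _
  have hVm : Measurable fun x => tiltedVar ν h (s * x) :=
    (measurable_tiltedVar hh).comp (measurable_const_mul s)
  have hRm : Measurable R := by
    refine (stronglyMeasurable_integral_tilted (X := ℝ × ℝ) (T := fun p l => s * p.1 * h l)
      (g := fun p l => Real.exp (s * p.2 * h l - s * p.2 * m p.1)) ?_ ?_).measurable <;>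
    · unfold Function.uncurry; fun_prop
  have hφm : Measurable φ := by
    refine Real.measurable_log.comp (StronglyMeasurable.integral_prod_right
      (f := fun x l => Real.exp (s * x * h l)) (Measurable.stronglyMeasurable ?_)).measurable
    unfold Function.uncurry; fun_prop
  have hexp : ∀ x, Integrable (fun l => Real.exp (s * x * h l)) ν := fun x =>
    integrable_exp_of_ae_abs_le (hh.const_mul _) (ae_abs_mul_le hM _)
  -- Linear growth: integrable noise alone makes φ of it integrable.
  have hφb : ∀ x, ‖φ x‖ ≤ ‖s * M * x‖ := fun x => by
    refine (abs_log_integral_exp_le (hh.const_mul _) (ae_abs_mul_le hM _)).trans ?_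
    rw [Real.norm_eq_abs, abs_mul, abs_mul, abs_mul, mul_right_comm]
    gcongr
    exact le_abs_self M
  have hξint : Integrable ξ P := by
    have : Integrable (fun x : ℝ => x) (P.map ξ) := by rw [hpair.law_noise]; exact hint
    exact this.comp_measurable hξm
  have hφint : ∀ {X : Ω → ℝ}, Measurable X → Integrable X P → Integrable (fun ω => φ (X ω)) P :=
    fun {X} hX hi => (hi.const_mul (s * M)).mono (hφm.comp hX).aestronglyMeasurable
      (ae_of_all _ fun ω => hφb _)
  have hφμ : Integrable φ μ :=
    (hint.const_mul (s * M)).mono hφm.aestronglyMeasurable (ae_of_all _ fun ω => hφb _)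
  have hφμ' : Integrable (fun x => φ ((1 + γ) * x)) μ :=
    ((hint.const_mul (1 + γ)).const_mul (s * M)).mono
      (hφm.comp (measurable_const_mul _)).aestronglyMeasurable (ae_of_all _ fun ω => hφb _)
  have hxm : Integrable (fun x => x * m x) μ :=
    hint.mul_bdd hmm.aestronglyMeasurable (ae_of_all _ fun x => hmM x)
  have hVint : Integrable (fun x => tiltedVar ν h (s * x)) μ :=
    integrable_of_ae_abs_le hVm (ae_of_all _ fun x => abs_tiltedVar_le hh hM _)
  have hVnn : ∀ x, 0 ≤ tiltedVar ν h x := fun x => integral_nonneg fun l => sq_nonneg _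
  have hRnn : ∀ p, 0 ≤ R p := fun p => integral_nonneg fun l => (Real.exp_pos _).le
  set B : ℝ → ℝ := fun x => 1 + (1 + ε) * γ * (s / 2) * tiltedVar ν h (s * x) +
      (s * (2 * M) ^ 2 * γ) ^ 2 with hB
  have hBint : Integrable B μ :=
    (((integrable_const _).add (hVint.const_mul _)).add (integrable_const _))
  have hBnn : ∀ x, 0 ≤ B x := fun x => by
    have := hVnn (s * x)
    positivity
  have hBeq : ∫ x, B x ∂μ = 1 + (1 + ε) * γ * (s / 2) * (∫ x, tiltedVar ν h (s * x) ∂μ) +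
      (s * (2 * M) ^ 2 * γ) ^ 2 := by
    exact integral_const_add_mul_add_const hVint _ _ _
  have hRl : ∫⁻ ω, ENNReal.ofReal (R (ξ ω, ζ ω)) ∂P ≤ ENNReal.ofReal (∫ x, B x ∂μ) := by
    have hmap := lintegral_map (μ := P) (f := fun p => ENNReal.ofReal (R p))
      (g := fun ω => (ξ ω, ζ ω)) hRm.ennreal_ofReal (hξm.prodMk hζm)
    rw [← hmap, hpair.conditional_law, Measure.lintegral_compProd hRm.ennreal_ofReal,
      ofReal_integral_eq_lintegral_ofReal hBint (ae_of_all _ hBnn)]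
    refine lintegral_mono_ae ?_
    -- The Laplace bound is only available on the support, which has full measure.
    filter_upwards [(Measure.support_mem_ae : μ.support ∈ ae μ)] with x hx
    exact lintegral_tilted_exp_le hh hM hs hγ hε hε1 (fun t h1 => hκ t h1 x hx) (ht x) (hv x) hγM
  have hRint : Integrable (fun ω => R (ξ ω, ζ ω)) P := by
    refine ⟨(hRm.comp (hξm.prodMk hζm)).aestronglyMeasurable, ?_⟩
    rw [hasFiniteIntegral_iff_ofReal (ae_of_all _ fun ω => hRnn _)]
    exact hRl.trans_lt ENNReal.ofReal_lt_top
  have hRle : ∫ ω, R (ξ ω, ζ ω) ∂P ≤ ∫ x, B x ∂μ := by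
    rw [← ENNReal.ofReal_le_ofReal_iff (integral_nonneg hBnn),
      ofReal_integral_eq_lintegral_ofReal hRint (ae_of_all _ fun ω => hRnn _)]
    exact hRl
  obtain ⟨hmζ, hmζ0⟩ := hpair.integral_mul_eq_zero hmm hmM
  have hpt1 : ∀ x, γ * s * (x * m x) ≤ φ ((1 + γ) * x) - φ x := fun x => by
    have hD : Integrable (fun l => γ * s * x * h l) (ν.tilted fun l => s * x * h l) := by
      refine integrable_of_ae_abs_le (hh.const_mul _) (M := |γ * s * x| * M)
        ((tilted_absolutelyContinuous ν _).ae_le (ae_abs_mul_le hM _))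
    have := integral_tilted_le_log_sub_log (hexp x) (D := fun l => γ * s * x * h l) (by
      convert hexp ((1 + γ) * x) using 3; ring) hD
    rw [integral_const_mul] at this
    convert this using 1
    · simp only [hm, tiltedMean]; ring
    · simp only [hφ]
      congr 4 with l; ring_nf
  -- Moving from ξ to ξ + ζ is a further tilt by s ζ h; the centring constant is its mean s ζ m(ξ).
  have hpt2 : ∀ ω, φ (ξ ω + ζ ω) - φ (ξ ω) ≤ s * (m (ξ ω) * ζ ω) + (R (ξ ω, ζ ω) - 1) := fun ω => by
    have := log_sub_log_le_integral_tilted (ν := ν) (T := fun l => s * ξ ω * h l)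
      (D := fun l => s * ζ ω * h l) (s * ζ ω * m (ξ ω)) (hexp _) (by
        convert hexp (ξ ω + ζ ω) using 3; ring)
    convert this using 1
    · simp only [hφ]
      congr 4 with l; ring_nf
    · simp only [hR]; ring
  have hE1 : γ * (s * ∫ x, x * m x ∂μ) ≤ ∫ x, φ ((1 + γ) * x) ∂μ - ∫ x, φ x ∂μ := by
    rw [← mul_assoc, ← integral_const_mul, ← integral_sub hφμ' hφμ]
    exact integral_mono (hxm.const_mul _) (hφμ'.sub hφμ) hpt1
  have hE2 : ∫ x, φ ((1 + γ) * x) ∂μ = ∫ ω, φ (ξ ω + ζ ω) ∂P := by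
    rw [← integral_map (measurable_const_mul _).aemeasurable hφm.aestronglyMeasurable,
      ← hpair.law_sum,
      integral_map (φ := fun ω => ξ ω + ζ ω) (hξm.add hζm).aemeasurable hφm.aestronglyMeasurable]
  have hE3 : ∫ x, φ x ∂μ = ∫ ω, φ (ξ ω) ∂P := by
    rw [← hpair.law_noise, integral_map hξm.aemeasurable hφm.aestronglyMeasurable]
  have hE4 : ∫ ω, φ (ξ ω + ζ ω) ∂P - ∫ ω, φ (ξ ω) ∂P ≤ ∫ ω, R (ξ ω, ζ ω) ∂P - 1 := by
    have h1 := hφint (X := fun ω => ξ ω + ζ ω) (hξm.add hζm) (hξint.add hpair.integrable_perturbation)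
    have h2 := hφint hξm hξint
    have h3 : Integrable (fun ω => R (ξ ω, ζ ω) - 1) P := hRint.sub (integrable_const _)
    have := integral_mono (h1.sub h2) ((hmζ.const_mul s).add h3) hpt2
    simp only [Pi.sub_apply, Pi.add_apply] at this
    rw [integral_sub h1 h2, integral_add (hmζ.const_mul s) h3, integral_const_mul, hmζ0,
      integral_sub hRint (integrable_const _)] at this
    simpa using this
  linarith

lemma two_mul_integral_tiltedMean_le (hh : Measurable h) (hM : ∀ᵐ l ∂ν, |h l| ≤ M)
    {μ : Measure ℝ} [IsProbabilityMeasure μ] (hint : Integrable (fun x : ℝ => x) μ)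
    {s : ℝ} {v : ℝ → ℝ≥0} {t₀ : ℝ≥0∞} (hN : AssumptionN μ t₀ v) (hs : 0 < s)
    (ht : ∀ x, ∀ᵐ l ∂ν, ENNReal.ofReal |s * (h l - tiltedMean ν h (s * x))| ≤ t₀)
    (hv : ∀ a, s * v a ≤ 1 / 2) :
    2 * ∫ x, x * tiltedMean ν h (s * x) ∂μ ≤ ∫ x, tiltedVar ν h (s * x) ∂μ := by
  set I := ∫ x, x * tiltedMean ν h (s * x) ∂μ
  set V := ∫ x, tiltedVar ν h (s * x) ∂μ
  have key : ∀ ε : ℝ, 0 < ε → ε ≤ 1 → s * I ≤ (1 + ε) * (s / 2) * V + ε := fun ε hε hε1 => by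
    set C := s * (2 * M) ^ 2
    have hC : 0 ≤ C := by positivity
    have hlim1 : ∀ᶠ γ in 𝓝[>] (0 : ℝ), C * γ < 1 := by
      have : Tendsto (fun γ : ℝ => C * γ) (𝓝[>] 0) (𝓝 (C * 0)) :=
        (continuous_const_mul C).continuousAt.tendsto.mono_left nhdsWithin_le_nhds
      exact this.eventually_lt_const (by simp)
    have hlim2 : ∀ᶠ γ in 𝓝[>] (0 : ℝ), C ^ 2 * γ < ε := by
      have : Tendsto (fun γ : ℝ => C ^ 2 * γ) (𝓝[>] 0) (𝓝 (C ^ 2 * 0)) :=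
        (continuous_const_mul (C ^ 2)).continuousAt.tendsto.mono_left nhdsWithin_le_nhds
      exact this.eventually_lt_const (by simpa using hε)
    obtain ⟨γ, ⟨Ω, mΩ, P, ξ, ζ, κ, hpair, hκ⟩, h1, h2, h3⟩ :=
      ((hN.eventually_exists hε).and (hlim1.and (hlim2.and self_mem_nhdsWithin))).exists
    have hγ : 0 < γ := h3
    have := mul_integral_tiltedMean_le_of_isDilationPair hh hM hint hs.le hγ.le hε.le hε1 hpair hκ
      ht hv h1.le
    -- After division by γ the remainder C²γ² becomes C²γ < ε.
    refine le_of_mul_le_mul_left (this.trans ?_) hγ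
    nlinarith [mul_le_mul_of_nonneg_left h2.le hγ.le]
  have hlim : s * I ≤ (1 + 0) * (s / 2) * V + 0 := by
    refine ge_of_tendsto (f := fun ε : ℝ => (1 + ε) * (s / 2) * V + ε) (x := 𝓝[>] (0 : ℝ)) ?_ ?_
    · have : Continuous (fun ε : ℝ => (1 + ε) * (s / 2) * V + ε) := by fun_prop
      exact (this.tendsto 0).mono_left nhdsWithin_le_nhds
    · filter_upwards [Ioc_mem_nhdsGT (show (0 : ℝ) < 1 by norm_num)] with ε hε
      exact key ε hε.1 hε.2
  nlinarith

end Dilation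

/-! ### The Gibbs posterior for bounded families -/

lemma abs_sub_integral_le {Λ : Type*} [MeasurableSpace Λ] {θ : Measure Λ} [IsProbabilityMeasure θ]
    {h : Λ → ℝ} (hint : Integrable h θ) {L : ℝ} (hL : ∀ l l', |h l - h l'| ≤ L) (l : Λ) :
    |h l - ∫ l', h l' ∂θ| ≤ L := by
  have : h l - ∫ l', h l' ∂θ = ∫ l', (h l - h l') ∂θ := by
    rw [integral_sub (integrable_const _) hint]; simp
  rw [this]
  exact abs_integral_le_of_ae_abs_le (ae_of_all _ (hL l))

lemma integral_sq_eq_add {Λ : Type*} [MeasurableSpace Λ] {θ : Measure Λ} [IsProbabilityMeasure θ]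
    {h : Λ → ℝ} {c : ℝ} (hint : Integrable h θ) (hsq : Integrable (fun l => (h l - c) ^ 2) θ)
    (hc : ∫ l, h l ∂θ = c) : ∫ l, h l ^ 2 ∂θ = ∫ l, (h l - c) ^ 2 ∂θ + c ^ 2 := by
  have h3 : ∀ l, h l ^ 2 = (h l - c) ^ 2 + (-(c ^ 2) + 2 * c * h l + 0) := fun l => by ring
  have h4 : Integrable (fun l => -(c ^ 2) + 2 * c * h l + 0) θ := by
    simpa using (integrable_const (-(c ^ 2))).add (hint.const_mul (2 * c))
  simp_rw [h3]
  rw [integral_add hsq h4, integral_const_add_mul_add_const hint, hc]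
  ring

/-- The exponent of the posterior, up to an additive constant, for the noise `x`. -/
noncomputable def gibbsExponent {Λ : Type*} {n : ℕ} (β : ℝ) (g : Fin n → Λ → ℝ) (x : Fin n → ℝ) (l : Λ) : ℝ :=
  β⁻¹ * ∑ i, (2 * x i * g i l - g i l ^ 2)

lemma gibbsExponent_insertNth {Λ : Type*} {β : ℝ} {m : ℕ} {g : Fin (m + 1) → Λ → ℝ} (i : Fin (m + 1)) (a : ℝ)
    (y : Fin m → ℝ) (l : Λ) :
    gibbsExponent β g (i.insertNth a y) l =
      gibbsExponent β g (i.insertNth 0 y) l + 2 * β⁻¹ * a * g i l := by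
  simp only [gibbsExponent, Fin.sum_univ_succAbove _ i, Fin.insertNth_apply_same,
    Fin.insertNth_apply_succAbove]
  ring

section Gibbs

variable {Λ : Type*} [MeasurableSpace Λ] {n : ℕ}

/-- The posterior mean of `g i` for the noise `x`. -/
noncomputable def gibbsMean (ρ : Measure Λ) (β : ℝ) (g : Fin n → Λ → ℝ) (x : Fin n → ℝ)
    (i : Fin n) : ℝ :=
  ∫ l, g i l ∂(ρ.tilted (gibbsExponent β g x))

/-- The posterior variance of `g i` for the noise `x`. -/
noncomputable def gibbsVar (ρ : Measure Λ) (β : ℝ) (g : Fin n → Λ → ℝ) (x : Fin n → ℝ)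
    (i : Fin n) : ℝ :=
  ∫ l, (g i l - gibbsMean ρ β g x i) ^ 2 ∂(ρ.tilted (gibbsExponent β g x))

variable {ρ : Measure Λ} {β : ℝ} {g : Fin n → Λ → ℝ}

lemma measurable_uncurry_gibbsExponent (hg : ∀ i, Measurable (g i)) :
    Measurable (Function.uncurry (gibbsExponent β g)) := by
  unfold Function.uncurry gibbsExponent
  fun_prop

lemma measurable_gibbsExponent (hg : ∀ i, Measurable (g i)) (x : Fin n → ℝ) :
    Measurable (gibbsExponent β g x) :=
  (measurable_uncurry_gibbsExponent hg).comp measurable_prodMk_left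

lemma measurable_gibbsMean [SFinite ρ] (hg : ∀ i, Measurable (g i)) (i : Fin n) :
    Measurable fun x => gibbsMean ρ β g x i :=
  (stronglyMeasurable_integral_tilted (T := gibbsExponent β g) (g := fun _ l => g i l)
    (measurable_uncurry_gibbsExponent hg)
    (by unfold Function.uncurry; fun_prop)).measurable

lemma measurable_gibbsVar [SFinite ρ] (hg : ∀ i, Measurable (g i)) (i : Fin n) :
    Measurable fun x => gibbsVar ρ β g x i := by
  have := measurable_gibbsMean (ρ := ρ) (β := β) hg i
  exact (stronglyMeasurable_integral_tilted (T := gibbsExponent β g)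
    (g := fun x l => (g i l - gibbsMean ρ β g x i) ^ 2)
    (measurable_uncurry_gibbsExponent hg)
    (by unfold Function.uncurry; fun_prop)).measurable

lemma ae_tilted_of_ae {p : Λ → Prop} (h : ∀ᵐ l ∂ρ, p l) (T : Λ → ℝ) : ∀ᵐ l ∂(ρ.tilted T), p l :=
  (tilted_absolutelyContinuous ρ T).ae_le h

lemma exists_ae_abs_gibbsExponent_le {M : ℝ} (hM : ∀ i, ∀ᵐ l ∂ρ, |g i l| ≤ M) (x : Fin n → ℝ) :
    ∃ K, ∀ᵐ l ∂ρ, |gibbsExponent β g x l| ≤ K := by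
  refine ⟨|β⁻¹| * ∑ i, (|2 * x i| * M + M ^ 2), ?_⟩
  filter_upwards [ae_all_iff.2 hM] with l hl
  unfold gibbsExponent
  rw [abs_mul]
  gcongr
  refine (Finset.abs_sum_le_sum_abs _ _).trans (Finset.sum_le_sum fun i _ => ?_)
  refine (abs_sub _ _).trans ?_
  rw [abs_mul, abs_pow]
  have := hl i
  gcongr

section Bounded

variable [IsFiniteMeasure ρ] {M : ℝ}

lemma integrable_exp_gibbsExponent (hg : ∀ i, Measurable (g i))
    (hM : ∀ i, ∀ᵐ l ∂ρ, |g i l| ≤ M) (x : Fin n → ℝ) :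
    Integrable (fun l => Real.exp (gibbsExponent β g x l)) ρ := by
  obtain ⟨K, hK⟩ := exists_ae_abs_gibbsExponent_le (β := β) hM x
  exact integrable_exp_of_ae_abs_le (measurable_gibbsExponent hg x) hK

/-- The exponent is affine in each noise coordinate, so varying one of them is a one-parameter tilt
with s = 2/β. -/
lemma tilted_gibbsExponent_insertNth {m : ℕ} {g : Fin (m + 1) → Λ → ℝ}
    (hg : ∀ i, Measurable (g i)) (hM : ∀ i, ∀ᵐ l ∂ρ, |g i l| ≤ M)
    (i : Fin (m + 1)) (a : ℝ) (y : Fin m → ℝ) :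
    ρ.tilted (gibbsExponent β g (i.insertNth a y)) =
      (ρ.tilted (gibbsExponent β g (i.insertNth 0 y))).tilted fun l => 2 * β⁻¹ * a * g i l := by
  rw [tilted_tilted (integrable_exp_gibbsExponent hg hM _)]
  congr with l
  exact gibbsExponent_insertNth i a y l

variable [NeZero ρ]

lemma isProbabilityMeasure_tilted_gibbsExponent (hg : ∀ i, Measurable (g i))
    (hM : ∀ i, ∀ᵐ l ∂ρ, |g i l| ≤ M) (x : Fin n → ℝ) :
    IsProbabilityMeasure (ρ.tilted (gibbsExponent β g x)) :=
  isProbabilityMeasure_tilted (integrable_exp_gibbsExponent hg hM x)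

lemma abs_gibbsMean_le (hg : ∀ i, Measurable (g i)) (hM : ∀ i, ∀ᵐ l ∂ρ, |g i l| ≤ M)
    (x : Fin n → ℝ) (i : Fin n) : |gibbsMean ρ β g x i| ≤ M := by
  have := isProbabilityMeasure_tilted_gibbsExponent (β := β) hg hM x
  exact abs_integral_le_of_ae_abs_le (ae_tilted_of_ae (hM i) _)

lemma ae_abs_sq_sub_gibbsMean_le (hg : ∀ i, Measurable (g i)) (hM : ∀ i, ∀ᵐ l ∂ρ, |g i l| ≤ M)
    (x : Fin n → ℝ) (i : Fin n) :
    ∀ᵐ l ∂ρ, |(g i l - gibbsMean ρ β g x i) ^ 2| ≤ (2 * M) ^ 2 := by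
  filter_upwards [hM i] with l hl
  rw [abs_pow]
  have := abs_gibbsMean_le (β := β) hg hM x i
  have h2 : |g i l - gibbsMean ρ β g x i| ≤ 2 * M := (abs_sub _ _).trans (by linarith)
  gcongr

lemma abs_gibbsVar_le (hg : ∀ i, Measurable (g i)) (hM : ∀ i, ∀ᵐ l ∂ρ, |g i l| ≤ M)
    (x : Fin n → ℝ) (i : Fin n) : |gibbsVar ρ β g x i| ≤ (2 * M) ^ 2 := by
  have := isProbabilityMeasure_tilted_gibbsExponent (β := β) hg hM x
  exact abs_integral_le_of_ae_abs_le (ae_tilted_of_ae (ae_abs_sq_sub_gibbsMean_le hg hM x i) _)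

lemma integral_sq_tilted_gibbsExponent (hg : ∀ i, Measurable (g i))
    (hM : ∀ i, ∀ᵐ l ∂ρ, |g i l| ≤ M) (x : Fin n → ℝ) (i : Fin n) :
    ∫ l, g i l ^ 2 ∂(ρ.tilted (gibbsExponent β g x)) =
      gibbsVar ρ β g x i + gibbsMean ρ β g x i ^ 2 := by
  have := isProbabilityMeasure_tilted_gibbsExponent (β := β) hg hM x
  have h1 : Integrable (fun l => (g i l - gibbsMean ρ β g x i) ^ 2)
      (ρ.tilted (gibbsExponent β g x)) :=
    integrable_of_ae_abs_le (by fun_prop) (ae_tilted_of_ae (ae_abs_sq_sub_gibbsMean_le hg hM x i) _)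
  have h2 : Integrable (g i) (ρ.tilted (gibbsExponent β g x)) :=
    integrable_of_ae_abs_le (hg i) (ae_tilted_of_ae (hM i) _)
  exact integral_sq_eq_add h2 h1 rfl

lemma integral_gibbsExponent_tilted (hg : ∀ i, Measurable (g i))
    (hM : ∀ i, ∀ᵐ l ∂ρ, |g i l| ≤ M) (x : Fin n → ℝ) :
    ∫ l, gibbsExponent β g x l ∂(ρ.tilted (gibbsExponent β g x)) =
      β⁻¹ * ∑ i, (2 * x i * gibbsMean ρ β g x i - gibbsVar ρ β g x i -
        gibbsMean ρ β g x i ^ 2) := by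
  have := isProbabilityMeasure_tilted_gibbsExponent (β := β) hg hM x
  have h2 : ∀ i, Integrable (g i) (ρ.tilted (gibbsExponent β g x)) := fun i =>
    integrable_of_ae_abs_le (hg i) (ae_tilted_of_ae (hM i) _)
  have h3 : ∀ i, Integrable (fun l => g i l ^ 2) (ρ.tilted (gibbsExponent β g x)) := fun i => by
    refine integrable_of_ae_abs_le (by fun_prop) (M := M ^ 2) (ae_tilted_of_ae ?_ _)
    filter_upwards [hM i] with l hl
    rw [abs_pow]
    gcongr
  conv_lhs => enter [2, l]; unfold gibbsExponent
  rw [integral_const_mul, integral_finsetSum (f := fun i l => 2 * x i * g i l - g i l ^ 2) _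
    fun i _ => ((h2 i).const_mul _).sub (h3 i)]
  congr 1
  refine Finset.sum_congr rfl fun i _ => ?_
  rw [integral_sub ((h2 i).const_mul _) (h3 i), integral_const_mul,
    integral_sq_tilted_gibbsExponent hg hM, gibbsMean]
  ring

/-- Both sides are compared with the log-partition function at `x`: its tangent at zero noise lies
below, and the posterior mean of the exponent lies above. -/
lemma log_integral_exp_gibbsExponent_le (hg : ∀ i, Measurable (g i))
    (hM : ∀ i, ∀ᵐ l ∂ρ, |g i l| ≤ M) (hρ : ρ Set.univ ≤ 1) (x : Fin n → ℝ) :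
    Real.log (∫ l, Real.exp (gibbsExponent β g 0 l) ∂ρ) +
        2 * β⁻¹ * ∑ i, x i * gibbsMean ρ β g 0 i ≤
      β⁻¹ * ∑ i, (2 * x i * gibbsMean ρ β g x i - gibbsVar ρ β g x i -
        gibbsMean ρ β g x i ^ 2) := by
  have hexp := integrable_exp_gibbsExponent (β := β) hg hM
  have hprob := isProbabilityMeasure_tilted_gibbsExponent (β := β) hg hM
  have hgint : ∀ x i, Integrable (g i) (ρ.tilted (gibbsExponent β g x)) := fun x i =>
    integrable_of_ae_abs_le (hg i) (ae_tilted_of_ae (hM i) _)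
  have hE : ∀ l, gibbsExponent β g 0 l + 2 * β⁻¹ * ∑ i, x i * g i l = gibbsExponent β g x l := by
    intro l
    simp only [gibbsExponent, Pi.zero_apply]
    rw [mul_comm 2 β⁻¹, mul_assoc, ← mul_add, Finset.mul_sum, ← Finset.sum_add_distrib]
    congr 1
    exact Finset.sum_congr rfl fun i _ => by ring
  have h1 := integral_tilted_le_log_sub_log (hexp 0) (D := fun l => 2 * β⁻¹ * ∑ i, x i * g i l)
    (by simp_rw [hE]; exact hexp x)
    ((integrable_finsetSum _ fun i _ => (hgint 0 i).const_mul _).const_mul _)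
  simp_rw [hE] at h1
  rw [integral_const_mul, integral_finsetSum _ fun i _ => (hgint 0 i).const_mul _] at h1
  simp_rw [integral_const_mul] at h1
  obtain ⟨K, hK⟩ := exists_ae_abs_gibbsExponent_le (β := β) hM x
  have hEint : Integrable (gibbsExponent β g x) (ρ.tilted (gibbsExponent β g x)) :=
    integrable_of_ae_abs_le (measurable_gibbsExponent hg x) (ae_tilted_of_ae hK _)
  -- Undoing the tilt leaves the total mass of ρ, whose logarithm is nonpositive. A mass below 1 is
  -- allowed, so truncated priors need no renormalization.
  have h2 := integral_tilted_le_log_sub_log (hexp x) (D := fun l => -gibbsExponent β g x l)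
    (by simp) hEint.neg
  have h3 : Real.log (ρ.real Set.univ) ≤ 0 :=
    Real.log_nonpos measureReal_nonneg (ENNReal.toReal_le_of_le_ofReal zero_le_one (by simpa using hρ))
  rw [integral_neg, integral_gibbsExponent_tilted hg hM] at h2
  simp only [add_neg_cancel, Real.exp_zero, integral_const, smul_eq_mul, mul_one] at h2
  have h1' : 2 * β⁻¹ * ∑ i, x i * gibbsMean ρ β g 0 i ≤ _ := h1
  linarith

/-! ### Averaging over the noise -/

section Noise

variable {μ : Measure ℝ} [IsProbabilityMeasure μ]

lemma integrable_eval_pi (hint : Integrable (fun x : ℝ => x) μ) (i : Fin n) :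
    Integrable (fun x : Fin n → ℝ => x i) (Measure.pi fun _ => μ) :=
  (measurePreserving_eval (fun _ : Fin n => μ) i).integrable_comp_of_integrable hint

lemma two_mul_integral_mul_gibbsMean_le (hg : ∀ i, Measurable (g i))
    (hM : ∀ i, ∀ᵐ l ∂ρ, |g i l| ≤ M) (hint : Integrable (fun x : ℝ => x) μ)
    {v : ℝ → ℝ≥0} {t₀ : ℝ≥0∞} (hN : AssumptionN μ t₀ v) (hβ : 0 < β)
    (ht : t₀ = ∞ ∨ ∃ L : ℝ, (∀ i l l', |g i l - g i l'| ≤ L) ∧ ENNReal.ofReal (2 * β⁻¹ * L) ≤ t₀)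
    (hv : ∀ a, 4 * (v a : ℝ) ≤ β) (i : Fin n) :
    ∫ x, (2 * (x i * gibbsMean ρ β g x i) - gibbsVar ρ β g x i) ∂(Measure.pi fun _ => μ) ≤ 0 := by
  cases n with
  | zero => exact i.elim0
  | succ m =>
  have hmean := measurable_gibbsMean (ρ := ρ) (β := β) hg i
  have hvar := measurable_gibbsVar (ρ := ρ) (β := β) hg i
  have hJ : Integrable (fun x : Fin (m + 1) → ℝ => 2 * (x i * gibbsMean ρ β g x i) -
      gibbsVar ρ β g x i) (Measure.pi fun _ => μ) :=
    (((integrable_eval_pi hint i).mul_bdd hmean.aestronglyMeasurable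
      (ae_of_all _ fun x => abs_gibbsMean_le hg hM x i)).const_mul 2).sub
      (integrable_of_ae_abs_le hvar (ae_of_all _ fun x => abs_gibbsVar_le hg hM x i))
  -- By independence, coordinate `i` is integrated first with the others frozen at `y`.
  have hmp := (measurePreserving_piFinSuccAbove (fun _ : Fin (m + 1) => μ) i).symm
  rw [← hmp.integrable_comp_emb (MeasurableEquiv.measurableEmbedding _)] at hJ
  rw [← hmp.integral_comp (MeasurableEquiv.measurableEmbedding _), integral_prod_symm _ (by exact hJ)]
  refine integral_nonpos fun y => ?_
  simp only [Pi.zero_apply, MeasurableEquiv.piFinSuccAbove_symm_apply, Fin.insertNthEquiv,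
    Equiv.coe_fn_mk, Fin.insertNth_apply_same]
  set ν := ρ.tilted (gibbsExponent β g (i.insertNth 0 y)) with hν
  have : IsProbabilityMeasure ν := isProbabilityMeasure_tilted_gibbsExponent hg hM _
  have hMν : ∀ᵐ l ∂ν, |g i l| ≤ M := ae_tilted_of_ae (hM i) _
  have e1 : ∀ a, gibbsMean ρ β g (i.insertNth a y) i = tiltedMean ν (g i) (2 * β⁻¹ * a) := by
    intro a
    simp only [gibbsMean, tilted_gibbsExponent_insertNth hg hM i a y, tiltedMean, hν]
  have e2 : ∀ a, gibbsVar ρ β g (i.insertNth a y) i = tiltedVar ν (g i) (2 * β⁻¹ * a) := by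
    intro a
    simp only [gibbsVar, e1, tilted_gibbsExponent_insertNth hg hM i a y, tiltedVar, hν]
  have hst : ∀ x, ∀ᵐ l ∂ν,
      ENNReal.ofReal |2 * β⁻¹ * (g i l - tiltedMean ν (g i) (2 * β⁻¹ * x))| ≤ t₀ := by
    intro x
    refine ae_of_all _ fun l => ?_
    rcases ht with rfl | ⟨L, hL, hLt⟩
    · exact le_top
    · refine le_trans (ENNReal.ofReal_le_ofReal ?_) hLt
      have := isProbabilityMeasure_tilted_of_ae_abs_le ((hg i).const_mul (2 * β⁻¹ * x))
        (ae_abs_mul_le hMν _)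
      rw [abs_mul, abs_of_pos (show 0 < 2 * β⁻¹ by positivity)]
      gcongr
      exact abs_sub_integral_le (integrable_of_ae_abs_le (hg i) (ae_tilted_of_ae hMν _)) (hL i) l
  have hsv : ∀ a, 2 * β⁻¹ * v a ≤ 1 / 2 := fun a => by
    have := mul_le_mul_of_nonneg_left (hv a) (inv_nonneg.2 hβ.le)
    rw [inv_mul_cancel₀ hβ.ne'] at this
    linarith
  have key := two_mul_integral_tiltedMean_le (hg i) hMν hint hN (s := 2 * β⁻¹) (by positivity)
    hst hsv
  have hm : Measurable fun a => tiltedMean ν (g i) (2 * β⁻¹ * a) :=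
    (measurable_tiltedMean (hg i)).comp (measurable_const_mul _)
  have hV : Measurable fun a => tiltedVar ν (g i) (2 * β⁻¹ * a) :=
    (measurable_tiltedVar (hg i)).comp (measurable_const_mul _)
  simp_rw [e1, e2]
  rw [integral_sub ((hint.mul_bdd hm.aestronglyMeasurable
      (ae_of_all _ fun x => abs_tiltedMean_le (hg i) hMν _)).const_mul 2)
    (integrable_of_ae_abs_le hV (ae_of_all _ fun x => abs_tiltedVar_le (hg i) hMν _)),
    integral_const_mul]
  linarith

theorem integral_sum_gibbsMean_sq_le (hg : ∀ i, Measurable (g i))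
    (hM : ∀ i, ∀ᵐ l ∂ρ, |g i l| ≤ M) (hρ : ρ Set.univ ≤ 1)
    (hint : Integrable (fun x : ℝ => x) μ) (hmean : ∫ x, x ∂μ = 0)
    {v : ℝ → ℝ≥0} {t₀ : ℝ≥0∞} (hN : AssumptionN μ t₀ v) (hβ : 0 < β)
    (ht : t₀ = ∞ ∨ ∃ L : ℝ, (∀ i l l', |g i l - g i l'| ≤ L) ∧ ENNReal.ofReal (2 * β⁻¹ * L) ≤ t₀)
    (hv : ∀ a, 4 * (v a : ℝ) ≤ β) :
    Integrable (fun x => ∑ i, gibbsMean ρ β g x i ^ 2) (Measure.pi fun _ => μ) ∧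
    ∫ x, ∑ i, gibbsMean ρ β g x i ^ 2 ∂(Measure.pi fun _ => μ) ≤
      -(β * Real.log (∫ l, Real.exp (gibbsExponent β g 0 l) ∂ρ)) := by
  set Q : Measure (Fin n → ℝ) := Measure.pi fun _ => μ
  have hxi : ∀ i, Integrable (fun x : Fin n → ℝ => x i) Q := fun i => integrable_eval_pi hint i
  have hx0 : ∀ i, ∫ x : Fin n → ℝ, x i ∂Q = 0 := fun i => by
    rw [← hmean, ← (measurePreserving_eval (fun _ : Fin n => μ) i).map_eq,
      integral_map (measurable_pi_apply i).aemeasurable (by fun_prop)]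
  have hm := fun i => measurable_gibbsMean (ρ := ρ) (β := β) hg i
  have hJ : ∀ i, Integrable (fun x : Fin n → ℝ => 2 * (x i * gibbsMean ρ β g x i) -
      gibbsVar ρ β g x i) Q := fun i =>
    (((hxi i).mul_bdd (hm i).aestronglyMeasurable
      (ae_of_all _ fun x => abs_gibbsMean_le hg hM x i)).const_mul 2).sub
      (integrable_of_ae_abs_le (measurable_gibbsVar hg i)
        (ae_of_all _ fun x => abs_gibbsVar_le hg hM x i))
  have hsq : ∀ i, Integrable (fun x => gibbsMean ρ β g x i ^ 2) Q := fun i => by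
    refine integrable_of_ae_abs_le ((hm i).pow_const 2) (M := M ^ 2) (ae_of_all _ fun x => ?_)
    rw [abs_pow]
    have := abs_gibbsMean_le (β := β) hg hM x i
    gcongr
  have hsum := integrable_finsetSum Finset.univ fun i _ => hsq i
  refine ⟨hsum, ?_⟩
  -- The tangent term is linear in `x` with deterministic coefficients, so it has mean zero.
  have hle : ∀ x : Fin n → ℝ, β * Real.log (∫ l, Real.exp (gibbsExponent β g 0 l) ∂ρ) +
      ∑ i, 2 * gibbsMean ρ β g 0 i * x i ≤
      ∑ i, (2 * (x i * gibbsMean ρ β g x i) - gibbsVar ρ β g x i) -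
        ∑ i, gibbsMean ρ β g x i ^ 2 := fun x => by
    have h := mul_le_mul_of_nonneg_left
      (log_integral_exp_gibbsExponent_le (β := β) hg hM hρ x) hβ.le
    rw [mul_add, mul_inv_cancel_left₀ hβ.ne', mul_comm 2 β⁻¹, mul_assoc β⁻¹,
      mul_inv_cancel_left₀ hβ.ne', Finset.mul_sum] at h
    rw [← Finset.sum_sub_distrib]
    refine le_trans (le_of_eq ?_) (h.trans (le_of_eq ?_))
    · congr 1
      exact Finset.sum_congr rfl fun i _ => by ring
    · exact Finset.sum_congr rfl fun i _ => by ring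
  have hI1 : Integrable (fun x : Fin n → ℝ => ∑ i, 2 * gibbsMean ρ β g 0 i * x i) Q :=
    integrable_finsetSum _ fun i _ => (hxi i).const_mul _
  have hI2 := integrable_finsetSum Finset.univ fun i _ => hJ i
  have h := integral_mono ((integrable_const _).add hI1) (hI2.sub hsum) hle
  simp only [Pi.add_apply, Pi.sub_apply] at h
  rw [integral_add (integrable_const _) hI1, integral_sub hI2 hsum,
    integral_finsetSum _ (fun i _ => (hxi i).const_mul _), integral_finsetSum _ fun i _ => hJ i] at h
  simp only [integral_const, probReal_univ, smul_eq_mul, one_mul, integral_const_mul, hx0 _, mul_zero,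
    Finset.sum_const_zero, add_zero] at h
  have := Finset.sum_nonpos fun i (_ : i ∈ Finset.univ) =>
    two_mul_integral_mul_gibbsMean_le hg hM hint hN hβ ht hv i
  linarith

end Noise

end Bounded

end Gibbs

/-! ### Unbounded families by truncating the prior -/

section Truncation

section

variable {Λ : Type*} {n : ℕ} {β : ℝ} {g : Fin n → Λ → ℝ}

/-- Completing the square bounds the exponent above uniformly in `l`, and identifies the posterior,
as constants do not affect tilting. -/
lemma gibbsExponent_eq (x : Fin n → ℝ) (l : Λ) :
    gibbsExponent β g x l = -(β⁻¹ * ∑ i, (x i - g i l) ^ 2) + β⁻¹ * ∑ i, x i ^ 2 := by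
  rw [gibbsExponent, neg_add_eq_sub, ← mul_sub, ← Finset.sum_sub_distrib]
  congr 1
  exact Finset.sum_congr rfl fun i _ => by ring

lemma exp_gibbsExponent_le (hβ : 0 < β) (x : Fin n → ℝ) (l : Λ) :
    Real.exp (gibbsExponent β g x l) ≤ Real.exp (β⁻¹ * ∑ i, x i ^ 2) := by
  rw [gibbsExponent_eq]
  have : 0 ≤ β⁻¹ * ∑ i, (x i - g i l) ^ 2 := by positivity
  exact Real.exp_le_exp.2 (by linarith)

/-- The Gaussian-type weight absorbs the growth of g: |g_i| ≤ |x_i| + 1 + βw, while e^{-w} w ≤ 1. -/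
lemma abs_mul_exp_gibbsExponent_le (hβ : 0 < β) (x : Fin n → ℝ) (i : Fin n) (l : Λ) :
    |Real.exp (gibbsExponent β g x l) * g i l| ≤
      Real.exp (β⁻¹ * ∑ i, x i ^ 2) * (|x i| + 1 + β) := by
  set w := β⁻¹ * ∑ i, (x i - g i l) ^ 2 with hw
  have hw0 : 0 ≤ w := by positivity
  have hu : (x i - g i l) ^ 2 ≤ β * w := by
    rw [hw, mul_inv_cancel_left₀ hβ.ne']
    exact Finset.single_le_sum (f := fun i => (x i - g i l) ^ 2) (fun _ _ => sq_nonneg _)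
      (Finset.mem_univ i)
  have hg : |g i l| ≤ |x i| + 1 + β * w := by
    have h1 : |g i l| ≤ |x i| + |x i - g i l| := by
      simpa using abs_sub (x i) (x i - g i l)
    nlinarith [sq_abs (x i - g i l), sq_nonneg (|x i - g i l| - 1), abs_nonneg (x i - g i l)]
  have he : Real.exp (-w) * w ≤ 1 := by
    have := Real.add_one_le_exp w
    rw [Real.exp_neg, inv_mul_le_iff₀ (Real.exp_pos w)]
    linarith
  have he1 : Real.exp (-w) ≤ 1 := Real.exp_le_one_iff.2 (by linarith)
  rw [gibbsExponent_eq, ← hw, add_comm, Real.exp_add, abs_mul, abs_of_pos (by positivity), mul_assoc]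
  gcongr
  calc Real.exp (-w) * |g i l| ≤ Real.exp (-w) * (|x i| + 1 + β * w) := by gcongr
    _ = Real.exp (-w) * (|x i| + 1) + β * (Real.exp (-w) * w) := by ring
    _ ≤ 1 * (|x i| + 1) + β * 1 := by gcongr
    _ = _ := by ring

/-- The parameters at which all the functions `g i` are bounded by `k`. -/
def boundedSet (g : Fin n → Λ → ℝ) (k : ℕ) : Set Λ := {l | ∀ i, |g i l| ≤ k}

lemma monotone_boundedSet : Monotone (boundedSet g) := fun _ _ hab _ hl i =>
  (hl i).trans (by exact_mod_cast hab)

lemma iUnion_boundedSet : ⋃ k, boundedSet g k = Set.univ := by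
  refine Set.eq_univ_of_forall fun l => Set.mem_iUnion.2 ?_
  obtain ⟨k, hk⟩ := exists_nat_ge (∑ i, |g i l|)
  exact ⟨k, fun i => (Finset.single_le_sum (f := fun i => |g i l|) (fun _ _ => abs_nonneg _)
    (Finset.mem_univ i)).trans hk⟩

end

variable {Λ : Type*} [MeasurableSpace Λ] {n : ℕ} {β : ℝ} {g : Fin n → Λ → ℝ} {π : Measure Λ}

lemma tilted_add_const (T : Λ → ℝ) (c : ℝ) : π.tilted (fun l => T l + c) = π.tilted T := by
  simp only [Measure.tilted, Real.exp_add, integral_mul_const]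
  congr with l
  rw [mul_div_mul_right _ _ (Real.exp_pos c).ne']

lemma measurableSet_boundedSet (hg : ∀ i, Measurable (g i)) (k : ℕ) :
    MeasurableSet (boundedSet g k) := by
  have : boundedSet g k = ⋂ i, {l | |g i l| ≤ k} := by ext l; simp [boundedSet]
  rw [this]
  exact MeasurableSet.iInter fun i => measurableSet_le (hg i).abs measurable_const

lemma tendsto_setIntegral_boundedSet (hg : ∀ i, Measurable (g i)) {φ : Λ → ℝ}
    (hφ : Integrable φ π) :
    Tendsto (fun k => ∫ l, φ l ∂(π.restrict (boundedSet g k))) atTop (𝓝 (∫ l, φ l ∂π)) := by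
  have := tendsto_setIntegral_of_monotone (f := φ) (μ := π) (measurableSet_boundedSet hg)
    monotone_boundedSet hφ.integrableOn
  rwa [iUnion_boundedSet, setIntegral_univ] at this

variable [IsFiniteMeasure π]

lemma integrable_exp_gibbsExponent_of_pos (hβ : 0 < β) (hg : ∀ i, Measurable (g i))
    (x : Fin n → ℝ) : Integrable (fun l => Real.exp (gibbsExponent β g x l)) π :=
  integrable_of_ae_abs_le (Real.measurable_exp.comp (measurable_gibbsExponent hg x))
    (ae_of_all _ fun l => by
      rw [abs_of_pos (Real.exp_pos _)]; exact exp_gibbsExponent_le hβ x l)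

lemma integrable_exp_gibbsExponent_mul (hβ : 0 < β) (hg : ∀ i, Measurable (g i))
    (x : Fin n → ℝ) (i : Fin n) :
    Integrable (fun l => Real.exp (gibbsExponent β g x l) * g i l) π :=
  integrable_of_ae_abs_le ((Real.measurable_exp.comp (measurable_gibbsExponent hg x)).mul (hg i))
    (ae_of_all _ fun l => abs_mul_exp_gibbsExponent_le hβ x i l)

lemma gibbsMean_eq_div (ρ : Measure Λ) (x : Fin n → ℝ) (i : Fin n) :
    gibbsMean ρ β g x i = (∫ l, Real.exp (gibbsExponent β g x l) * g i l ∂ρ) /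
      ∫ l, Real.exp (gibbsExponent β g x l) ∂ρ := by
  rw [gibbsMean, integral_tilted, ← integral_div]
  simp only [smul_eq_mul, div_mul_eq_mul_div]

/-- Posterior means for the restricted priors converge pointwise in the noise, being ratios of
convergent integrals; Fatou passes the bounded case to the limit. -/
theorem lintegral_sum_gibbsMean_sq_le [NeZero π] (hg : ∀ i, Measurable (g i))
    (hπ : π Set.univ ≤ 1) {μ : Measure ℝ} [IsProbabilityMeasure μ]
    (hint : Integrable (fun x : ℝ => x) μ) (hmean : ∫ x, x ∂μ = 0)
    {v : ℝ → ℝ≥0} {t₀ : ℝ≥0∞} (hN : AssumptionN μ t₀ v) (hβ : 0 < β)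
    (ht : t₀ = ∞ ∨ ∃ L : ℝ, (∀ i l l', |g i l - g i l'| ≤ L) ∧ ENNReal.ofReal (2 * β⁻¹ * L) ≤ t₀)
    (hv : ∀ a, 4 * (v a : ℝ) ≤ β) :
    ∫⁻ x, ENNReal.ofReal (∑ i, gibbsMean π β g x i ^ 2) ∂(Measure.pi fun _ => μ) ≤
      ENNReal.ofReal (-(β * Real.log (∫ l, Real.exp (gibbsExponent β g 0 l) ∂π))) := by
  have hexp := integrable_exp_gibbsExponent_of_pos (π := π) hβ hg
  have hlim : ∀ x, Tendsto (fun k : ℕ => ENNReal.ofReal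
      (∑ i, gibbsMean (π.restrict (boundedSet g k)) β g x i ^ 2)) atTop
      (𝓝 (ENNReal.ofReal (∑ i, gibbsMean π β g x i ^ 2))) := fun x => by
    refine ENNReal.tendsto_ofReal (tendsto_finsetSum _ fun i _ => Tendsto.pow ?_ 2)
    simp_rw [gibbsMean_eq_div]
    exact (tendsto_setIntegral_boundedSet hg (integrable_exp_gibbsExponent_mul hβ hg x i)).div
      (tendsto_setIntegral_boundedSet hg (hexp x)) (integral_exp_pos (hexp x)).ne'
  have hlim0 : Tendsto (fun k : ℕ => ENNReal.ofReal (-(β * Real.log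
      (∫ l, Real.exp (gibbsExponent β g 0 l) ∂(π.restrict (boundedSet g k)))))) atTop
      (𝓝 (ENNReal.ofReal (-(β * Real.log (∫ l, Real.exp (gibbsExponent β g 0 l) ∂π))))) :=
    ENNReal.tendsto_ofReal (((tendsto_setIntegral_boundedSet hg (hexp 0)).log
      (integral_exp_pos (hexp 0)).ne').const_mul β).neg
  -- The first restrictions may be the zero measure, to which the bounded case does not apply.
  have hpos : ∀ᶠ k in atTop, π (boundedSet g k) ≠ 0 := by
    have h := tendsto_measure_iUnion_atTop (μ := π) (monotone_boundedSet (g := g))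
    rw [iUnion_boundedSet] at h
    filter_upwards [h.eventually_const_lt (u := 0)
      (pos_iff_ne_zero.2 (Measure.measure_univ_ne_zero.2 (NeZero.ne π)))] with k hk using hk.ne'
  have hle : ∀ᶠ k : ℕ in atTop, ∫⁻ x, ENNReal.ofReal
      (∑ i, gibbsMean (π.restrict (boundedSet g k)) β g x i ^ 2) ∂(Measure.pi fun _ => μ) ≤
      ENNReal.ofReal (-(β * Real.log
      (∫ l, Real.exp (gibbsExponent β g 0 l) ∂(π.restrict (boundedSet g k))))) := by
    filter_upwards [hpos] with k hk
    have : NeZero (π.restrict (boundedSet g k)) := ⟨by rwa [Ne, Measure.restrict_eq_zero]⟩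
    obtain ⟨h1, h2⟩ := integral_sum_gibbsMean_sq_le (ρ := π.restrict (boundedSet g k)) hg (M := k)
      (fun i => (ae_restrict_mem (measurableSet_boundedSet hg k)).mono fun l hl => hl i)
      ((Measure.restrict_apply_le _ _).trans hπ) hint hmean hN hβ ht hv
    rw [← ofReal_integral_eq_lintegral_ofReal h1 (ae_of_all _ fun x => by positivity)]
    exact ENNReal.ofReal_le_ofReal h2
  calc ∫⁻ x, ENNReal.ofReal (∑ i, gibbsMean π β g x i ^ 2) ∂(Measure.pi fun _ => μ)
      = ∫⁻ x, liminf (fun k : ℕ => ENNReal.ofReal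
          (∑ i, gibbsMean (π.restrict (boundedSet g k)) β g x i ^ 2)) atTop
          ∂(Measure.pi fun _ => μ) :=
        lintegral_congr fun x => (hlim x).liminf_eq.symm
    _ ≤ liminf (fun k : ℕ => ∫⁻ x, ENNReal.ofReal
          (∑ i, gibbsMean (π.restrict (boundedSet g k)) β g x i ^ 2)
          ∂(Measure.pi fun _ => μ)) atTop := by
        refine lintegral_liminf_le fun k => Measurable.ennreal_ofReal ?_
        exact Finset.measurable_sum _ fun i _ => (measurable_gibbsMean hg i).pow_const 2
    _ ≤ liminf (fun k : ℕ => ENNReal.ofReal (-(β * Real.log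
          (∫ l, Real.exp (gibbsExponent β g 0 l) ∂(π.restrict (boundedSet g k)))))) atTop :=
        liminf_le_liminf hle
    _ = _ := hlim0.liminf_eq

end Truncation

/-- The Donsker–Varadhan inequality for a nonnegative potential. -/
lemma ofReal_neg_log_integral_exp_le {Λ : Type*} [MeasurableSpace Λ] {π p : Measure Λ}
    [IsProbabilityMeasure π] [IsProbabilityMeasure p] {U : Λ → ℝ} (hU : Measurable U)
    (hU0 : ∀ l, 0 ≤ U l) {β : ℝ} (hβ : 0 < β) :
    ENNReal.ofReal (-(β * Real.log (∫ l, Real.exp (-(β⁻¹ * U l)) ∂π))) ≤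
      ∫⁻ l, ENNReal.ofReal (U l) ∂p + ENNReal.ofReal β * InformationTheory.klDiv p π := by
  by_cases hkl : InformationTheory.klDiv p π = ∞
  · simp [hkl, ENNReal.mul_top, hβ]
  by_cases hUp : ∫⁻ l, ENNReal.ofReal (U l) ∂p = ∞
  · simp [hUp]
  obtain ⟨hac, hllr⟩ := InformationTheory.klDiv_ne_top_iff.1 hkl
  have hUint : Integrable U p := by
    refine ⟨hU.aestronglyMeasurable, ?_⟩
    rw [hasFiniteIntegral_iff_ofReal (ae_of_all _ hU0)]
    exact lt_top_iff_ne_top.2 hUp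
  have hT : Integrable (fun l => Real.exp (-(β⁻¹ * U l))) π := by
    refine integrable_of_ae_abs_le (by fun_prop) (M := 1) (ae_of_all _ fun l => ?_)
    have := hU0 l
    rw [abs_of_pos (Real.exp_pos _), Real.exp_le_one_iff, neg_nonpos]
    positivity
  have hTp : Integrable (fun l => -(β⁻¹ * U l)) p := (hUint.const_mul _).neg
  have hprob := isProbabilityMeasure_tilted hT
  have h1 := integral_llr_tilted_right hac hTp hT hllr
  -- The inequality is the nonnegativity of the divergence of `p` from the tilted prior, expanded
  -- with `h1`.
  have h2 := InformationTheory.integral_llr_add_sub_measure_univ_nonneg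
    (hac.trans (absolutelyContinuous_tilted hT)) (integrable_llr_tilted_right hac hTp hllr hT)
  rw [h1, integral_neg, integral_const_mul] at h2
  simp only [probReal_univ] at h2
  rw [InformationTheory.klDiv_of_ac_of_integrable hac hllr,
    ← ofReal_integral_eq_lintegral_ofReal hUint (ae_of_all _ hU0), ← ENNReal.ofReal_mul hβ.le]
  refine le_trans (ENNReal.ofReal_le_ofReal ?_) ENNReal.ofReal_add_le
  simp only [probReal_univ, add_sub_cancel_right]
  have h3 := mul_le_mul_of_nonneg_left h2 hβ.le
  have h4 : β * (β⁻¹ * ∫ l, U l ∂p) = ∫ l, U l ∂p := mul_inv_cancel_left₀ hβ.ne' _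
  linarith

/-! ### Return to the regression model -/

section Aggregate

variable {𝒵 Λ : Type*} [MeasurableSpace Λ] {n : ℕ} (Z : Fin n → 𝒵) (f : 𝒵 → ℝ)
  (F : Λ → 𝒵 → ℝ) {π : Measure Λ} {β : ℝ}

lemma posterior_eq_tilted (x : Fin n → ℝ) :
    posterior Z F π β (fun i => f (Z i) + x i) =
      π.tilted (gibbsExponent β (fun i l => F l (Z i) - f (Z i)) x) := by
  have h : gibbsExponent β (fun i l => F l (Z i) - f (Z i)) x =
      fun l => -(β⁻¹ * ∑ i, (f (Z i) + x i - F l (Z i)) ^ 2) + β⁻¹ * ∑ i, x i ^ 2 := by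
    funext l
    rw [gibbsExponent_eq]
    simp only [sub_sub_eq_add_sub, add_comm]
  rw [h, tilted_add_const, _root_.posterior]

lemma ewa_sub_eq_gibbsMean [IsFiniteMeasure π] [NeZero π] (hF : ∀ z, Measurable fun l => F l z)
    (hβ : 0 < β) (x : Fin n → ℝ) (i : Fin n) :
    ewa Z F π β (fun i => f (Z i) + x i) (Z i) - f (Z i) =
      gibbsMean π β (fun i l => F l (Z i) - f (Z i)) x i := by
  have hg : ∀ i, Measurable fun l => F l (Z i) - f (Z i) := fun i => (hF _).sub_const _
  have hexp := integrable_exp_gibbsExponent_of_pos (π := π) hβ hg x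
  have hprob := isProbabilityMeasure_tilted hexp
  rw [ewa, posterior_eq_tilted, gibbsMean]
  have hi : Integrable (fun l => F l (Z i) - f (Z i))
      (π.tilted (gibbsExponent β (fun i l => F l (Z i) - f (Z i)) x)) := by
    rw [integrable_tilted_iff hexp]
    exact integrable_exp_gibbsExponent_mul hβ hg x i
  have h : ∀ l, F l (Z i) = (F l (Z i) - f (Z i)) + f (Z i) := fun l => by ring
  conv_lhs => enter [1, 2, l]; rw [h l]
  rw [integral_add hi (integrable_const _)]
  simp

lemma ofReal_empiricalNorm_sq (h : 𝒵 → ℝ) :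
    ENNReal.ofReal (empiricalNorm Z h ^ 2) =
      (n : ℝ≥0∞)⁻¹ * ENNReal.ofReal (∑ i, h (Z i) ^ 2) := by
  rw [empiricalNorm, Real.sq_sqrt (by positivity)]
  rcases Nat.eq_zero_or_pos n with rfl | hn
  · simp
  rw [ENNReal.ofReal_mul (by positivity), one_div, ENNReal.ofReal_inv_of_pos (by exact_mod_cast hn),
    ENNReal.ofReal_natCast]

end Aggregate

lemma four_mul_le_of_supNorm_le {v : ℝ → ℝ≥0} {β : ℝ} (hβ : 0 < β)
    (h : 4 * supNorm v ≤ ENNReal.ofReal β) (a : ℝ) : 4 * (v a : ℝ) ≤ β := by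
  have h1 : 4 * (v a : ℝ≥0∞) ≤ ENNReal.ofReal β :=
    le_trans (by gcongr; exact le_iSup (fun a => (v a : ℝ≥0∞)) a) h
  rw [← ENNReal.ofReal_le_ofReal_iff hβ.le, ENNReal.ofReal_mul (by norm_num),
    ENNReal.ofReal_coe_nnreal]
  simpa using h1

/-- For t₀ = ∞ the quotient is 0 and says nothing about the deviation, but no constraint is needed
then; for finite t₀ it forces a finite deviation. -/
lemma exists_deviation_bound {𝒵 Λ : Type*} {n : ℕ} {Z : Fin n → 𝒵} {F : Λ → 𝒵 → ℝ}
    {t₀ : ℝ≥0∞} (ht₀ : t₀ ≠ 0) {β : ℝ} (hβ : 0 < β)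
    (h : 2 * supDeviation Z F / t₀ ≤ ENNReal.ofReal β) :
    t₀ = ∞ ∨ ∃ L : ℝ, (∀ i l l', |F l (Z i) - F l' (Z i)| ≤ L) ∧
      ENNReal.ofReal (2 * β⁻¹ * L) ≤ t₀ := by
  refine or_iff_not_imp_left.2 fun htop => ?_
  rw [ENNReal.div_le_iff ht₀ htop] at h
  have hfin : supDeviation Z F ≠ ∞ := fun hL => by
    rw [hL, ENNReal.mul_top (by norm_num)] at h
    exact ENNReal.mul_ne_top ENNReal.ofReal_ne_top htop (top_le_iff.1 h)
  refine ⟨(supDeviation Z F).toReal, fun i l l' => ?_, ?_⟩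
  · rw [← ENNReal.ofReal_le_iff_le_toReal hfin]
    exact le_iSup_of_le l (le_iSup_of_le l' (le_iSup_of_le i le_rfl))
  · rw [mul_right_comm, mul_comm, ENNReal.ofReal_mul (by positivity),
      ENNReal.ofReal_mul (by norm_num), ENNReal.ofReal_toReal hfin,
      ENNReal.ofReal_inv_of_pos hβ, ENNReal.inv_mul_le_iff (by simpa using hβ) ENNReal.ofReal_ne_top]
    simpa using h

/-- In `[0, ∞]` one has `2 * ∞ / ∞ = 0`, so the case of an infinite deviation with `t₀ = ∞` is included,
with the condition `4 ‖v‖_∞ ≤ β`. -/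
theorem theorem1 {𝒵 Λ Ω : Type*} [MeasurableSpace Λ] [MeasurableSpace Ω]
    (n : ℕ) (hn : 0 < n) (Z : Fin n → 𝒵)
    (f : 𝒵 → ℝ) (F : Λ → 𝒵 → ℝ) (hF : ∀ z, Measurable (fun l => F l z))
    (P : Measure Ω) [IsProbabilityMeasure P]
    (μ : Measure ℝ) [IsProbabilityMeasure μ]
    (ξ : Fin n → Ω → ℝ) (hξ : ∀ i, Measurable (ξ i))
    (hindep : iIndepFun ξ P) (hlaw : ∀ i, P.map (ξ i) = μ)
    (hint : Integrable (fun x : ℝ => x) μ) (hmean : ∫ x, x ∂μ = 0)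
    (t₀ : ℝ≥0∞) (v : ℝ → ℝ≥0) (hN : AssumptionN μ t₀ v)
    (π : Measure Λ) [IsProbabilityMeasure π] (p : Measure Λ) [IsProbabilityMeasure p]
    (β : ℝ) (hβ_pos : 0 < β)
    (hβ : max (4 * supNorm v) (2 * supDeviation Z F / t₀) ≤ ENNReal.ofReal β) :
    ∫⁻ ω, ENNReal.ofReal
        (empiricalNorm Z (fun z => ewa Z F π β (fun i => f (Z i) + ξ i ω) z - f z) ^ 2) ∂P ≤
      ∫⁻ l, ENNReal.ofReal (empiricalNorm Z (fun z => f z - F l z) ^ 2) ∂p +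
        ENNReal.ofReal β * InformationTheory.klDiv p π / (n : ℝ≥0∞) := by
  have hn0 : (n : ℝ≥0∞) ≠ 0 := by exact_mod_cast hn.ne'
  set g : Fin n → Λ → ℝ := fun i l => F l (Z i) - f (Z i) with hg_def
  have hg : ∀ i, Measurable (g i) := fun i => (hF _).sub_const _
  have hv := four_mul_le_of_supNorm_le hβ_pos ((le_max_left _ _).trans hβ)
  have ht := exists_deviation_bound hN.1.ne' hβ_pos ((le_max_right _ _).trans hβ)
  have hgF : ∀ i l l', g i l - g i l' = F l (Z i) - F l' (Z i) := fun i l l' => by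
    simp only [hg_def]; ring
  simp_rw [← hgF] at ht
  have hmain := lintegral_sum_gibbsMean_sq_le (π := π) hg (by simp) hint hmean hN hβ_pos ht hv
  have hmap : P.map (fun ω i => ξ i ω) = Measure.pi fun _ => μ := by
    rw [(iIndepFun_iff_map_fun_eq_pi_map fun i => (hξ i).aemeasurable).1 hindep]
    simp_rw [hlaw]
  have hmeas : Measurable fun x => ENNReal.ofReal (∑ i, gibbsMean π β g x i ^ 2) :=
    Measurable.ennreal_ofReal
      (Finset.measurable_sum _ fun i _ => (measurable_gibbsMean hg i).pow_const 2)
  rw [← hmap, lintegral_map hmeas (measurable_pi_lambda _ hξ)] at hmain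
  have hDV := ofReal_neg_log_integral_exp_le (π := π) (p := p) (U := fun l => ∑ i, g i l ^ 2)
    (by fun_prop) (fun l => by positivity) hβ_pos
  -- At zero noise the exponent is minus the squared risk over β, the potential used in
  -- Donsker–Varadhan.
  have hE0 : ∀ l, gibbsExponent β g 0 l = -(β⁻¹ * ∑ i, g i l ^ 2) := fun l => by
    simp [gibbsExponent_eq]
  simp_rw [hE0] at hmain
  simp_rw [ofReal_empiricalNorm_sq, ewa_sub_eq_gibbsMean Z f F hF hβ_pos]
  have hsq : ∀ l, ∑ i, (f (Z i) - F l (Z i)) ^ 2 = ∑ i, g i l ^ 2 := fun l =>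
    Finset.sum_congr rfl fun i _ => by simp only [hg_def]; ring
  simp_rw [hsq]
  rw [lintegral_const_mul' _ _ (ENNReal.inv_ne_top.2 hn0),
    lintegral_const_mul' _ _ (ENNReal.inv_ne_top.2 hn0), ENNReal.div_eq_inv_mul, ← mul_add]
  gcongr
  exact hmain.trans hDV
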